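/- Let $(X,\rho)$ be an arbitrary metric space (neither separability nor completeness is assumed), let $B_b(X)$ and $C_b(X)$ be the spaces of bounded Borel measurable and of bounded continuous real functions on $X$, and let $\mathcal M_1$ be the set of Borel probability measures on $X$. Let $(P_t)_{t\ge 0}$ be a stochastically continuous Feller semigroup on $X$, that is, a semigroup of positive linear operators on $B_b(X)$ (with $P_0=\mathrm{Id}$ and $P_{s+t}=P_sP_t$) such that $P_t\mathbf 1_X=\mathbf 1_X$ and $P_t(C_b(X))\subset C_b(X)$ for all $t\ge 0$, such that $\lim_{t\to 0^+}P_t\psi(x)=\psi(x)$ for all $\psi\in C_b(X)$ and $x\in X$, and which has a dual semigroup $P_t^*:\mathcal M_1\to\mathcal M_1$, i.e. $\int P_t\varphi\,d\mu=\int\varphi\,d(P_t^*\mu)$ for all $\varphi\in B_b(X)$, $\mu\in\mathcal M_1$, $t\ge 0$. Suppose that for every $\varphi\in C_b(X)$ the family $(P_t\varphi)_{t\ge0}$ is equicontinuous at every point of $X$. The semigroup is called asymptotically stable if it has a unique invariant measure $\mu_*\in\mathcal M_1$ (i.e. $P_t^*\mu_*=\mu_*$ for all $t\ge 0$), and $P_t^*\mu$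 converges weakly to $\mu_*$ as $t\to\infty$ for every $\mu\in\mathcal M_1$. Consider the condition $$\text{(L)}\qquad\text{there is } z\in X \text{ such that, for every } \varepsilon>0,\quad \inf_{x\in X}\ \liminf_{t\to\infty}\ P_t^*\delta_x\bigl(B(z,\varepsilon)\bigr)>0 .$$ 1. If (L) holds, then $(P_t)_{t\ge 0}$ is asymptotically stable. 2. Conversely, suppose that the density character of $X$ is a non-measurable cardinal, i.e. that $X$ has a dense subset $D$ such that no probability measure defined on all subsets of $D$ vanishes on all singletons (this holds whenever $X$ is separable). If $(P_t)_{t\ge0}$ is asymptotically stable, then (L) holds. In particular, on such a space $X$, $(P_t)_{t\ge 0}$ is asymptotically stable if and only if (L) holds. -/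

import Mathlib

open Filter Topology MeasureTheory
open scoped NNReal ENNReal BoundedContinuousFunction

/-- The space `B_b(X)` of bounded Borel measurable real functions on `X`. -/
def BoundedBorel (X : Type*) [MeasurableSpace X] : Submodule ℝ (X → ℝ) where
  carrier := {f | Measurable f ∧ ∃ C : ℝ, ∀ x, |f x| ≤ C}
  zero_mem' := ⟨measurable_const, 0, fun x => by simp⟩
  add_mem' := by
    rintro f g ⟨hf, C, hC⟩ ⟨hg, D, hD⟩
    exact ⟨hf.add hg, C + D, fun x => (abs_add_le _ _).trans (add_le_add (hC x) (hD x))⟩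
  smul_mem' := by
    rintro c f ⟨hf, C, hC⟩
    refine ⟨hf.const_smul c, |c| * C, fun x => ?_⟩
    simpa [abs_mul] using mul_le_mul_of_nonneg_left (hC x) (abs_nonneg c)

namespace BoundedBorel

/-- The constant function `1` as an element of `B_b(X)`. -/
def one (X : Type*) [MeasurableSpace X] : BoundedBorel X :=
  ⟨fun _ => 1, measurable_const, 1, fun _ => by simp⟩

/-- The inclusion of `C_b(X)` in `B_b(X)`. -/
def ofCb {X : Type*} [TopologicalSpace X] [MeasurableSpace X] [BorelSpace X]
    (φ : X →ᵇ ℝ) : BoundedBorel X :=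
  ⟨fun x => φ x, φ.continuous.measurable, ‖φ‖, fun x => by
    simpa [Real.norm_eq_abs] using φ.norm_coe_le_norm x⟩

end BoundedBorel

/-- A probability measure is determined by its integrals against `B_b(X)`. -/
theorem BoundedBorel.eq_of_integral_eq {X : Type*} [MeasurableSpace X] {μ ν : ProbabilityMeasure X}
    (h : ∀ φ : BoundedBorel X, ∫ x, φ.1 x ∂(μ : Measure X) = ∫ x, φ.1 x ∂(ν : Measure X)) :
    μ = ν := by
  apply Subtype.ext
  refine Measure.ext fun A hA => ?_
  have key := h ⟨A.indicator (fun _ => 1), measurable_const.indicator hA, 1, fun x => by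
    by_cases hx : x ∈ A <;> simp [hx]⟩
  simp only [integral_indicator_const (1 : ℝ) hA, smul_eq_mul, mul_one] at key
  have := μ.2
  have := ν.2
  exact (measureReal_eq_measureReal_iff (measure_ne_top _ _) (measure_ne_top _ _)).1 key

/-- A stochastically continuous Feller semigroup on a metric space `X`: a semigroup of positive
linear operators on `B_b(X)` with `P_t 1 = 1` and `P_t (C_b(X)) ⊆ C_b(X)`, together with a family of
dual maps on the Borel probability measures. The duality determines `dual`, and makes it a
semigroup (`dual_zero`, `dual_add` below). -/
structure FellerSemigroup (X : Type*) [MetricSpace X] [MeasurableSpace X] [BorelSpace X] where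
  /-- the operators `P_t` -/
  op : ℝ≥0 → BoundedBorel X →ₗ[ℝ] BoundedBorel X
  op_zero : op 0 = LinearMap.id
  op_add : ∀ s t, op (s + t) = (op s).comp (op t)
  op_one : ∀ t, op t (BoundedBorel.one X) = BoundedBorel.one X
  op_nonneg : ∀ t (φ : BoundedBorel X), (∀ x, 0 ≤ φ.1 x) → ∀ x, 0 ≤ (op t φ).1 x
  feller : ∀ t (φ : X →ᵇ ℝ), Continuous (op t (BoundedBorel.ofCb φ)).1
  stochCont : ∀ (φ : X →ᵇ ℝ) (x : X),
    Tendsto (fun t : ℝ≥0 => (op t (BoundedBorel.ofCb φ)).1 x) (𝓝[>] 0) (𝓝 (φ x))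
  /-- the dual operators `P_t^*` -/
  dual : ℝ≥0 → ProbabilityMeasure X → ProbabilityMeasure X
  duality : ∀ t (φ : BoundedBorel X) (μ : ProbabilityMeasure X),
    ∫ x, (op t φ).1 x ∂(μ : Measure X) = ∫ x, φ.1 x ∂(dual t μ : Measure X)

namespace FellerSemigroup

variable {X : Type*} [MetricSpace X] [MeasurableSpace X] [BorelSpace X]

theorem dual_zero (S : FellerSemigroup X) (μ : ProbabilityMeasure X) : S.dual 0 μ = μ :=
  BoundedBorel.eq_of_integral_eq fun φ => by rw [← S.duality, S.op_zero]; rfl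

theorem dual_add (S : FellerSemigroup X) (s t : ℝ≥0) (μ : ProbabilityMeasure X) :
    S.dual (s + t) μ = S.dual s (S.dual t μ) :=
  BoundedBorel.eq_of_integral_eq fun φ => by
    rw [← S.duality, ← S.duality, ← S.duality, add_comm, S.op_add]; rfl

/-- The e-property for bounded continuous functions: for every `φ ∈ C_b(X)` the family
`(P_t φ)_{t ≥ 0}` is equicontinuous at every point. -/
def EPropertyCb (S : FellerSemigroup X) : Prop :=
  ∀ (φ : X →ᵇ ℝ) (x : X),
    EquicontinuousAt (fun (t : ℝ≥0) (y : X) => (S.op t (BoundedBorel.ofCb φ)).1 y) x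

/-- `μ` is invariant: `P_t^* μ = μ` for all `t`. -/
def IsInvariant (S : FellerSemigroup X) (μ : ProbabilityMeasure X) : Prop :=
  ∀ t, S.dual t μ = μ

/-- Asymptotic stability: there is exactly one invariant probability measure, and `P_t^* μ`
converges weakly to it for every probability measure `μ` (the topology of `ProbabilityMeasure X`
is that of weak convergence). -/
def AsymptoticallyStable (S : FellerSemigroup X) : Prop :=
  ∃ μ₀ : ProbabilityMeasure X, S.IsInvariant μ₀ ∧ (∀ μ, S.IsInvariant μ → μ = μ₀) ∧
    ∀ μ, Tendsto (fun t : ℝ≥0 => S.dual t μ) atTop (𝓝 μ₀)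

/-- The lower bound condition: for some `z` and all `ε > 0`,
`inf_x liminf_{t → ∞} (P_t^* δ_x)(B(z, ε)) > 0`. The values are in `[0, ∞]`, where infima and lower
limits always exist. -/
def LowerBound (S : FellerSemigroup X) : Prop :=
  ∃ z : X, ∀ ε : ℝ, 0 < ε →
    0 < ⨅ x : X, liminf
      (fun t : ℝ≥0 => (S.dual t ⟨Measure.dirac x, inferInstance⟩ : Measure X) (Metric.ball z ε))
      atTop

end FellerSemigroup

/-- The density character of `X` is not a measurable cardinal (in the sense of Ulam): some dense
subset `D` carries no probability measure, defined on all subsets of `D`, that vanishes on all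
singletons. Every separable space has this property (take `D` countable), and it is consistent with
ZFC that every metric space has it. -/
def NonmeasurableDensity (X : Type*) [TopologicalSpace X] : Prop :=
  ∃ D : Set X, Dense D ∧ ∀ m : @Measure D ⊤, @IsProbabilityMeasure D ⊤ m → ∃ d : D, m {d} ≠ 0

/-! ### Escape of mass along decreasing sequences: a Baire category argument. -/

section WeakSequentialCompleteness

variable {X : Type*} [MetricSpace X]

/-! Sufficiency of (L). Near `z` the e-property makes every `P_t f` almost constant, uniformly in
`t`, and (L) sends a fixed fraction `δ` of any initial distribution into that neighbourhood.
Splitting off this fraction from two distributions at a common time and repeating with the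
remainders contracts the difference of their integrals by `1 - δ` each time, up to a small error.
Hence any two trajectories merge weakly (`tendsto_integral_dual_sub`).

It remains to find an invariant measure, and tightness is not available. Take an ultrafilter limit
`Λ` of the Cesàro means of `P_k f (z)`. It is positive and invariant, so `P_1` is a contraction for
the semi-inner product `Λ (f * g)`, and the mean ergodic theorem makes the Cesàro means Cauchy in
this seminorm. By the e-property and (L), a gap at `z` between two means forces a definite seminorm
distance, so the means also converge at `z` (`cauchySeq_cesaroMean_apply`). Alexandrov's theorem
(`exists_tendsto_of_tendsto_integral`) turns convergence of all integrals into a weak limit measure.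
Merging makes it invariant, attracting and unique.

Necessity. By the portmanteau theorem (L) holds at every point of the support of the invariant
measure. Non-measurability of the density character ensures that the support is nonempty
(`exists_forall_ball_measure_pos`). -/

theorem hasSum_telescope_of_antitone {u : ℕ → ℝ} (hu : Antitone u)
    (h0 : Tendsto u atTop (𝓝 0)) (K : ℕ) :
    HasSum (fun k => if K ≤ k then u k - u (k + 1) else 0) (u K) := by
  have h1 : HasSum (fun k => u (k + K) - u (k + K + 1)) (u K) := by
    rw [hasSum_iff_tendsto_nat_of_nonneg fun k => sub_nonneg.2 (hu (Nat.le_succ _))]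
    have : ∀ n, ∑ k ∈ Finset.range n, (u (k + K) - u (k + K + 1)) = u K - u (n + K) := by
      intro n
      induction n with
      | zero => simp
      | succ n ih => rw [Finset.sum_range_succ, ih, show n + 1 + K = n + K + 1 by ring]; ring
    simp_rw [this]
    simpa using tendsto_const_nhds.sub (h0.comp (tendsto_add_atTop_nat K))
  have h2 := (hasSum_nat_add_iff (f := fun k => if K ≤ k then u k - u (k + 1) else 0) K).1
    (by simpa using h1)
  rwa [Finset.sum_eq_zero, add_zero] at h2
  intro i hi
  simp [Finset.mem_range.1 hi]

theorem exists_forall_eq_lt_mem_of_mem_interior {E : Set (ℕ → Bool)} {a : ℕ → Bool}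
    (ha : a ∈ interior E) : ∃ K : ℕ, ∀ b : ℕ → Bool, (∀ k < K, b k = a k) → b ∈ E := by
  obtain ⟨I, u, hu, hI⟩ := isOpen_pi_iff.1 isOpen_interior a ha
  refine ⟨I.sup id + 1, fun b hb => interior_subset (hI fun i hi => ?_)⟩
  rw [hb i (Nat.lt_succ_of_le (Finset.le_sup (f := id) hi))]
  exact (hu i hi).2

/-- Sums of the increments of `f` selected by `a`. -/
noncomputable def selectedSum (f : ℕ → X →ᵇ ℝ) (a : ℕ → Bool) (x : X) : ℝ :=
  ∑' k, if a k then f k x - f (k + 1) x else 0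

section

variable {f : ℕ → X →ᵇ ℝ} (hf : ∀ x, Antitone fun k => f k x)
  (h0 : ∀ x, Tendsto (fun k => f k x) atTop (𝓝 0))

include hf h0

theorem summable_selectedSum (a : ℕ → Bool) (x : X) :
    Summable fun k => if a k then f k x - f (k + 1) x else 0 := by
  have hs := (hasSum_telescope_of_antitone (hf x) (h0 x) 0).summable
  simp only [Nat.zero_le, if_true] at hs
  refine Summable.of_nonneg_of_le (fun k => ?_) (fun k => ?_) hs
  all_goals
    have := hf x (Nat.le_succ k)
    simp only [Nat.succ_eq_add_one] at this
    split_ifs <;> linarith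

theorem selectedSum_sub_sum_mem (a : ℕ → Bool) (x : X) (K : ℕ) :
    0 ≤ selectedSum f a x - ∑ k ∈ Finset.range K, (if a k then f k x - f (k + 1) x else 0) ∧
    selectedSum f a x - ∑ k ∈ Finset.range K, (if a k then f k x - f (k + 1) x else 0)
      ≤ f K x := by
  have hs := summable_selectedSum hf h0 a x
  have e : selectedSum f a x - ∑ k ∈ Finset.range K, (if a k then f k x - f (k + 1) x else 0)
      = ∑' k, if a (k + K) then f (k + K) x - f (k + K + 1) x else 0 := by
    rw [selectedSum, ← hs.sum_add_tsum_nat_add K]; ring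
  have hm : ∀ k, f (k + 1) x ≤ f k x := fun k => hf x (Nat.le_succ k)
  rw [e]
  refine ⟨tsum_nonneg fun k => ?_, ?_⟩
  · have := hm (k + K)
    split_ifs <;> linarith
  · have h1 := hasSum_telescope_of_antitone
      (u := fun k => f (k + K) x) (fun i j hij => hf x (by omega))
      ((h0 x).comp (tendsto_add_atTop_nat K)) 0
    simp only [Nat.zero_le, if_true, zero_add] at h1
    rw [← h1.tsum_eq]
    refine Summable.tsum_le_tsum (fun k => ?_) ((summable_nat_add_iff K).2 hs) h1.summable
    have := hm (k + K)
    rw [show k + 1 + K = k + K + 1 by ring]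
    split_ifs <;> linarith

theorem selectedSum_mem (a : ℕ → Bool) (x : X) :
    0 ≤ selectedSum f a x ∧ selectedSum f a x ≤ f 0 x := by
  simpa using selectedSum_sub_sum_mem hf h0 a x 0

theorem norm_selectedSum_le (a : ℕ → Bool) (x : X) : ‖selectedSum f a x‖ ≤ ‖f 0‖ := by
  obtain ⟨h1, h2⟩ := selectedSum_mem hf h0 a x
  rw [Real.norm_eq_abs, abs_of_nonneg h1]
  exact h2.trans ((le_abs_self _).trans ((f 0).norm_coe_le_norm x))

/-- The tail after `K` terms lies between `0` and `f K`, which tends to `0` locally uniformly by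
Dini's theorem. -/
theorem continuous_selectedSum (a : ℕ → Bool) : Continuous (selectedSum f a) := by
  have hd : TendstoLocallyUniformly (fun k x => f k x) (fun _ => (0 : ℝ)) atTop :=
    Antitone.tendstoLocallyUniformly_of_forall_tendsto (fun k => (f k).continuous)
      (fun i j hij x => hf x hij) continuous_const h0
  have ht : TendstoLocallyUniformly
      (fun (K : ℕ) x => ∑ k ∈ Finset.range K, (if a k then f k x - f (k + 1) x else 0))
      (selectedSum f a) atTop := by
    rw [Metric.tendstoLocallyUniformly_iff] at hd ⊢
    intro ε hε x
    obtain ⟨t, ht, h⟩ := hd ε hε x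
    refine ⟨t, ht, h.mono fun K hK y hy => ?_⟩
    obtain ⟨h1, h2⟩ := selectedSum_sub_sum_mem hf h0 a y K
    have h3 := hK y hy
    rw [Real.dist_eq] at h3 ⊢
    rw [abs_of_nonneg h1]
    rw [zero_sub, abs_neg] at h3
    exact lt_of_le_of_lt (h2.trans (le_abs_self _)) h3
  refine ht.continuous (Frequently.of_forall fun K => ?_)
  refine continuous_finsetSum _ fun k _ => ?_
  split_ifs
  · exact (f k).continuous.sub (f (k + 1)).continuous
  · exact continuous_const

theorem continuous_selectedSum_left (x : X) : Continuous fun a => selectedSum f a x := by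
  have hs := (hasSum_telescope_of_antitone (hf x) (h0 x) 0).summable
  simp only [Nat.zero_le, if_true] at hs
  refine continuous_tsum (fun k => ?_) hs fun k a => ?_
  · exact (continuous_of_discreteTopology
      (f := fun b : Bool => if b then f k x - f (k + 1) x else 0)).comp (continuous_apply k)
  · have := hf x (Nat.le_succ k)
    simp only [Nat.succ_eq_add_one] at this
    split_ifs
    · rw [Real.norm_eq_abs, abs_of_nonneg (by linarith)]
    · simpa using this

theorem selectedSum_sub_selectedSum (a : ℕ → Bool) {K K' : ℕ} (hK : K ≤ K') (x : X) :
    selectedSum f (fun k => if k < K then a k else decide (K' ≤ k)) x -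
      selectedSum f (fun k => if k < K then a k else false) x = f K' x := by
  have h1 := (summable_selectedSum hf h0
    (fun k => if k < K then a k else decide (K' ≤ k)) x).hasSum.sub
    (summable_selectedSum hf h0 (fun k => if k < K then a k else false) x).hasSum
  refine h1.unique ?_
  convert! hasSum_telescope_of_antitone (hf x) (h0 x) K' using 2 with k
  by_cases h : k < K
  · have : ¬ K' ≤ k := by omega
    simp [h, this]
  · simp [h]

variable [MeasurableSpace X] [BorelSpace X]

/-- Each `a` in the Cantor space gives a test function `selectedSum f a`, whose integrals are
Cauchy. By Baire the Cauchy bound is uniform in `a` on some cylinder, and `f K'` is a difference of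
two test functions from that cylinder. -/
theorem exists_eventually_integral_le_of_antitone (μs : ℕ → ProbabilityMeasure X)
    (h : ∀ g : X →ᵇ ℝ, CauchySeq fun n => ∫ x, g x ∂(μs n : Measure X)) {ε : ℝ} (hε : 0 < ε) :
    ∃ K, ∀ᶠ n in atTop, ∫ x, f K x ∂(μs n : Measure X) ≤ ε := by
  let F : (ℕ → Bool) → X →ᵇ ℝ := fun a => BoundedContinuousFunction.ofNormedAddCommGroup
    (selectedSum f a) (continuous_selectedSum hf h0 a) ‖f 0‖ (norm_selectedSum_le hf h0 a)
  let φ : ℕ → (ℕ → Bool) → ℝ := fun n a => ∫ x, F a x ∂(μs n : Measure X)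
  have hφ : ∀ n, Continuous (φ n) := fun n =>
    continuous_of_dominated (bound := fun _ => ‖f 0‖)
      (fun a => ((F a).integrable _).aestronglyMeasurable)
      (fun a => ae_of_all _ fun x => norm_selectedSum_le hf h0 a x) (integrable_const _)
      (ae_of_all _ fun x => continuous_selectedSum_left hf h0 x)
  have hcl : ∀ N, IsClosed {a | ∀ n ≥ N, |φ n a - φ N a| ≤ ε / 3} := by
    intro N
    simp only [Set.ofPred_forall]
    exact isClosed_iInter fun n => isClosed_iInter fun _ =>
      isClosed_le ((hφ n).sub (hφ N)).abs continuous_const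
  have hun : ⋃ N, {a | ∀ n ≥ N, |φ n a - φ N a| ≤ ε / 3} = Set.univ := by
    refine Set.eq_univ_of_forall fun a => ?_
    obtain ⟨N, hN⟩ := Metric.cauchySeq_iff'.1 (h (F a)) (ε / 3) (by positivity)
    exact Set.mem_iUnion.2 ⟨N, fun n hn => (hN n hn).le⟩
  obtain ⟨N, a, ha⟩ := nonempty_interior_of_iUnion_of_closed hcl hun
  obtain ⟨K, hK⟩ := exists_forall_eq_lt_mem_of_mem_interior ha
  have hlim : Tendsto (fun k => ∫ x, f k x ∂(μs N : Measure X)) atTop (𝓝 0) := by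
    have := tendsto_integral_of_dominated_convergence (F := fun k x => f k x)
      (f := fun _ => (0 : ℝ)) (μ := (μs N : Measure X)) (fun _ => ‖f 0‖)
      (fun k => ((f k).integrable _).aestronglyMeasurable) (integrable_const _)
      (fun k => ae_of_all _ fun x => by
        have h1 : 0 ≤ f k x := (hf x).le_of_tendsto (h0 x) k
        rw [Real.norm_eq_abs, abs_of_nonneg h1]
        exact (hf x (Nat.zero_le k)).trans ((le_abs_self _).trans ((f 0).norm_coe_le_norm x)))
      (ae_of_all _ h0)
    simpa using this
  obtain ⟨K', hK'1, hK'2⟩ := ((hlim.eventually (ge_mem_nhds (show (0 : ℝ) < ε / 3 by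
    positivity))).and (eventually_ge_atTop K)).exists
  refine ⟨K', eventually_atTop.2 ⟨N, fun n hn => ?_⟩⟩
  have key : ∀ n, ∫ x, f K' x ∂(μs n : Measure X) =
      φ n (fun k => if k < K then a k else decide (K' ≤ k)) -
        φ n (fun k => if k < K then a k else false) := by
    intro n
    rw [← integral_sub ((F _).integrable _) ((F _).integrable _)]
    exact integral_congr_ae (ae_of_all _ fun x =>
      (selectedSum_sub_selectedSum hf h0 a hK'2 x).symm)
  -- Each of the two points of the cylinder costs `ε / 3`, and the integral of `f K'` against `μs N`
  -- costs the last third.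
  have h1 := abs_le.1 (hK (fun k => if k < K then a k else decide (K' ≤ k))
    (fun k hk => by simp [hk]) n hn)
  have h2 := abs_le.1 (hK (fun k => if k < K then a k else false)
    (fun k hk => by simp [hk]) n hn)
  have h3 := key n
  rw [key N] at hK'1
  linarith [h1.2, h2.1]

end

end WeakSequentialCompleteness

/-! ### Alexandrov's theorem: building the weak limit from its values on open sets. -/

section WeakLimit

variable {X : Type*} [MetricSpace X]

theorem exists_monotone_tendsto_indicator {U : Set X} (hU : IsOpen U) :
    ∃ b : ℕ → X →ᵇ ℝ, (∀ k x, 0 ≤ b k x) ∧ (∀ k x, b k x ≤ U.indicator 1 x) ∧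
      (∀ x, Monotone fun k => b k x) ∧ ∀ x ∈ U, Tendsto (fun k => b k x) atTop (𝓝 1) := by
  have δpos : ∀ k : ℕ, 0 < 1 / ((k : ℝ) + 1) := fun k => Nat.one_div_pos_of_nat
  have δlim : Tendsto (fun k : ℕ => 1 / ((k : ℝ) + 1)) atTop (𝓝 0) :=
    tendsto_one_div_add_atTop_nhds_zero_nat
  let t : ℕ → X →ᵇ ℝ≥0 := fun k => thickenedIndicator (δpos k) Uᶜ
  have hle : ∀ k x, (t k x : ℝ) ≤ 1 := fun k x =>
    NNReal.coe_le_one.2 (thickenedIndicator_le_one (δpos k) Uᶜ x)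
  refine ⟨fun k => BoundedContinuousFunction.ofNormedAddCommGroup
    (fun x => 1 - (t k x : ℝ)) (by fun_prop) 1 fun x => ?_, fun k x => ?_, fun k x => ?_,
    fun x i j hij => ?_, fun x hx => ?_⟩
  · rw [Real.norm_eq_abs, abs_le]
    constructor <;> linarith [hle k x, (t k x).coe_nonneg]
  · exact sub_nonneg.2 (hle k x)
  · by_cases hx : x ∈ U
    · simp [hx]
    · have : t k x = 1 := thickenedIndicator_one (δpos k) Uᶜ hx
      simp [hx, this]
  · have : t j x ≤ t i x := thickenedIndicator_mono (δpos j) (δpos i)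
      (one_div_le_one_div_of_le (by positivity) (by gcongr)) Uᶜ x
    exact sub_le_sub_left (NNReal.coe_le_coe.2 this) 1
  · have h := tendsto_pi_nhds.1 (thickenedIndicator_tendsto_indicator_closure δpos δlim Uᶜ) x
    rw [hU.isClosed_compl.closure_eq, Set.indicator_of_notMem (by simpa using hx)] at h
    have h' : Tendsto (fun k => (t k x : ℝ)) atTop (𝓝 0) :=
      (NNReal.continuous_coe.tendsto 0).comp h
    simpa using (tendsto_const_nhds (x := (1 : ℝ))).sub h'

/-- The content of `U` given by a functional `L` on `C_b(X)`. -/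
noncomputable def lowerContent (L : (X →ᵇ ℝ) → ℝ) (U : Set X) : ℝ≥0∞ :=
  ⨆ (f : X →ᵇ ℝ) (_ : (∀ x, 0 ≤ f x) ∧ ∀ x, f x ≤ U.indicator 1 x), ENNReal.ofReal (L f)

theorem le_lowerContent (L : (X →ᵇ ℝ) → ℝ) {U : Set X} {f : X →ᵇ ℝ} (h0 : ∀ x, 0 ≤ f x)
    (h1 : ∀ x, f x ≤ U.indicator 1 x) : ENNReal.ofReal (L f) ≤ lowerContent L U :=
  le_iSup₂_of_le f ⟨h0, h1⟩ le_rfl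

theorem lowerContent_mono (L : (X →ᵇ ℝ) → ℝ) {U V : Set X} (h : U ⊆ V) :
    lowerContent L U ≤ lowerContent L V :=
  iSup₂_le fun _ hf => le_lowerContent L hf.1 fun x => (hf.2 x).trans
    (Set.indicator_le_indicator_of_subset h (fun _ => zero_le_one) x)

variable [MeasurableSpace X]

section

variable {μs : ℕ → ProbabilityMeasure X} {L : (X →ᵇ ℝ) → ℝ}
  (hL : ∀ f : X →ᵇ ℝ, Tendsto (fun n => ∫ x, f x ∂(μs n : Measure X)) atTop (𝓝 (L f)))

include hL

theorem limit_nonneg {f : X →ᵇ ℝ} (hf : ∀ x, 0 ≤ f x) : 0 ≤ L f :=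
  ge_of_tendsto' (hL f) fun _ => integral_nonneg hf

variable [BorelSpace X]

theorem limit_add (f g : X →ᵇ ℝ) : L (f + g) = L f + L g := by
  refine tendsto_nhds_unique (hL (f + g)) (((hL f).add (hL g)).congr fun n => ?_)
  exact (integral_add (f.integrable _) (g.integrable _)).symm

theorem limit_sum {ι : Type*} (s : Finset ι) (f : ι → X →ᵇ ℝ) :
    L (∑ i ∈ s, f i) = ∑ i ∈ s, L (f i) := by
  classical
  induction s using Finset.induction_on with
  | empty =>
    refine tendsto_nhds_unique (hL _) ?_
    simp
  | insert i s hi ih => rw [Finset.sum_insert hi, Finset.sum_insert hi, limit_add hL, ih]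

theorem lowerContent_empty : lowerContent L ∅ = 0 := by
  refine le_antisymm (iSup₂_le fun f hf => ?_) zero_le
  have : f = 0 := by
    ext x
    exact le_antisymm (by simpa using hf.2 x) (hf.1 x)
  subst this
  have := limit_sum hL (∅ : Finset ℕ) fun _ => 0
  simp only [Finset.sum_empty] at this
  simp [this]

theorem lowerContent_univ : lowerContent L Set.univ = 1 := by
  apply le_antisymm
  · refine iSup₂_le fun f hf => ENNReal.ofReal_le_one.2 ?_
    refine le_of_tendsto' (hL f) fun n => ?_
    calc ∫ x, f x ∂(μs n : Measure X) ≤ ∫ x, (1 : ℝ) ∂(μs n : Measure X) :=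
          integral_mono (f.integrable _) (integrable_const _) fun x => by simpa using hf.2 x
      _ = 1 := by simp
  · have h1 : L 1 = 1 := tendsto_nhds_unique (hL 1) (by simp)
    rw [← ENNReal.ofReal_one, ← h1]
    exact le_lowerContent L (fun x => by simp) fun x => by simp

theorem lowerContent_le_liminf {U : Set X} (hU : IsOpen U) :
    lowerContent L U ≤ liminf (fun n => (μs n : Measure X) U) atTop := by
  refine iSup₂_le fun f hf => ?_
  rw [← ((ENNReal.continuous_ofReal.tendsto _).comp (hL f)).liminf_eq]
  refine liminf_le_liminf (Eventually.of_forall fun n => ?_)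
  refine ENNReal.ofReal_le_of_le_toReal ?_
  calc ∫ x, f x ∂(μs n : Measure X) ≤ ∫ x, U.indicator 1 x ∂(μs n : Measure X) :=
        integral_mono (f.integrable _) ((integrable_const (1 : ℝ)).indicator hU.measurableSet) hf.2
    _ = (μs n : Measure X).real U := integral_indicator_one hU.measurableSet

theorem lowerContent_add_le {U V W : Set X} (hUV : Disjoint U V) (hW : U ∪ V ⊆ W) :
    lowerContent L U + lowerContent L V ≤ lowerContent L W := by
  have h : ∀ {A : Set X}, lowerContent L A = ⨆ f : {f : X →ᵇ ℝ //
      (∀ x, 0 ≤ f x) ∧ ∀ x, f x ≤ A.indicator 1 x}, ENNReal.ofReal (L f) := fun {A} => by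
    rw [lowerContent, iSup_subtype']
  have hne : ∀ A : Set X, Nonempty {f : X →ᵇ ℝ //
      (∀ x, 0 ≤ f x) ∧ ∀ x, f x ≤ A.indicator 1 x} := fun A =>
    ⟨⟨0, fun x => le_rfl, fun x => Set.indicator_nonneg (fun _ _ => zero_le_one) x⟩⟩
  have := hne U
  have := hne V
  rw [h (A := U), h (A := V)]
  refine ENNReal.iSup_add_iSup_le fun f g => ?_
  rw [← ENNReal.ofReal_add (limit_nonneg hL f.2.1) (limit_nonneg hL g.2.1), ← limit_add hL]
  refine le_lowerContent L (fun x => add_nonneg (f.2.1 x) (g.2.1 x)) fun x => ?_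
  have h1 := f.2.2 x
  have h2 := g.2.2 x
  change f.1 x + g.1 x ≤ _
  by_cases hxU : x ∈ U
  · have hxV : x ∉ V := Set.disjoint_left.1 hUV hxU
    have hxW : x ∈ W := hW (Or.inl hxU)
    simp only [hxU, hxV, hxW, Set.indicator_of_mem, Set.indicator_of_notMem, not_false_eq_true,
      Pi.one_apply] at h1 h2 ⊢
    linarith
  · by_cases hxV : x ∈ V
    · have hxW : x ∈ W := hW (Or.inr hxV)
      simp only [hxU, hxV, hxW, Set.indicator_of_mem, Set.indicator_of_notMem, not_false_eq_true,
        Pi.one_apply] at h1 h2 ⊢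
      linarith
    · have : (0 : ℝ) ≤ W.indicator 1 x := Set.indicator_nonneg (fun _ _ => zero_le_one) x
      simp only [hxU, hxV, Set.indicator_of_notMem, not_false_eq_true] at h1 h2
      linarith

/-- Subtract from `f` finite sums of functions increasing to the indicators of the `U i`. The
positive parts of the differences decrease to `0` pointwise, so by the Baire lemma one of them has
integral at most `ε` for all late `n`. -/
theorem lowerContent_iUnion_le {U : ℕ → Set X} (hU : ∀ i, IsOpen (U i)) :
    lowerContent L (⋃ i, U i) ≤ ∑' i, lowerContent L (U i) := by
  refine iSup₂_le fun f hf => ENNReal.le_of_forall_pos_le_add fun ε hε _ => ?_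
  choose b hb0 hb1 hbm hbt using fun i => exists_monotone_tendsto_indicator (hU i)
  let h : ℕ → X →ᵇ ℝ := fun k => ∑ i ∈ Finset.range k, b i k
  have hx : ∀ k x, h k x = ∑ i ∈ Finset.range k, b i k x := fun k x => by
    simp [h]
  let g : ℕ → X →ᵇ ℝ := fun k => (f - h k) ⊔ 0
  have hg : ∀ k x, g k x = max (f x - h k x) 0 := fun k x => rfl
  have hh : ∀ x, Monotone fun k => h k x := by
    intro x i j hij
    simp only [hx]
    calc ∑ l ∈ Finset.range i, b l i x ≤ ∑ l ∈ Finset.range i, b l j x :=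
          Finset.sum_le_sum fun l _ => hbm l x hij
      _ ≤ _ := Finset.sum_le_sum_of_subset_of_nonneg (Finset.range_mono hij)
          fun l _ _ => hb0 l j x
  have hle : ∀ {k i} x, i < k → b i k x ≤ h k x := fun {k i} x hik => by
    rw [hx]
    exact Finset.single_le_sum (f := fun i => b i k x) (fun l _ => hb0 l k x)
      (Finset.mem_range.2 hik)
  have hganti : ∀ x, Antitone fun k => g k x := fun x i j hij =>
    max_le_max (sub_le_sub_left (hh x hij) _) le_rfl
  have hg0 : ∀ x, Tendsto (fun k => g k x) atTop (𝓝 0) := by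
    intro x
    by_cases hxU : x ∈ ⋃ i, U i
    · obtain ⟨i, hi⟩ := Set.mem_iUnion.1 hxU
      have hlim : Tendsto (fun k => max (1 - b i k x) 0) atTop (𝓝 0) := by
        simpa using ((tendsto_const_nhds (x := (1 : ℝ))).sub (hbt i x hi)).max
          (tendsto_const_nhds (x := (0 : ℝ)))
      refine tendsto_of_tendsto_of_tendsto_of_le_of_le' tendsto_const_nhds hlim
        (Eventually.of_forall fun k => le_max_right _ _) ?_
      filter_upwards [eventually_gt_atTop i] with k hk
      refine max_le_max (sub_le_sub ?_ (hle x hk)) le_rfl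
      simpa [hxU] using hf.2 x
    · have : ∀ k, g k x = 0 := fun k => by
        rw [hg, max_eq_right]
        have h1 : f x ≤ 0 := by simpa only [Set.indicator_of_notMem hxU] using hf.2 x
        have h2 : 0 ≤ h k x := by
          rw [hx]
          exact Finset.sum_nonneg fun l _ => hb0 l k x
        linarith
      simp [this]
  obtain ⟨K, hK⟩ := exists_eventually_integral_le_of_antitone hganti hg0 μs
    (fun g => (hL g).cauchySeq) (NNReal.coe_pos.2 hε)
  have h1 : L f ≤ L (h K) + ε := by
    refine le_of_tendsto_of_tendsto (hL f) ((hL (h K)).add tendsto_const_nhds) ?_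
    filter_upwards [hK] with n hn
    calc ∫ x, f x ∂(μs n : Measure X) ≤ ∫ x, (h K x + g K x) ∂(μs n : Measure X) :=
          integral_mono (f.integrable _) (((h K).integrable _).add ((g K).integrable _))
            fun x => by
              have := le_max_left (f x - h K x) 0
              simp only [hg]
              linarith
      _ = ∫ x, h K x ∂(μs n : Measure X) + ∫ x, g K x ∂(μs n : Measure X) :=
          integral_add ((h K).integrable _) ((g K).integrable _)
      _ ≤ _ := by gcongr
  calc ENNReal.ofReal (L f) ≤ ENNReal.ofReal (L (h K) + ε) := ENNReal.ofReal_le_ofReal h1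
    _ ≤ ENNReal.ofReal (L (h K)) + ENNReal.ofReal ε := ENNReal.ofReal_add_le
    _ = ∑ i ∈ Finset.range K, ENNReal.ofReal (L (b i K)) + ε := by
        rw [limit_sum hL, ENNReal.ofReal_sum_of_nonneg fun i _ => limit_nonneg hL (hb0 i K),
          ENNReal.ofReal_coe_nnreal]
    _ ≤ ∑ i ∈ Finset.range K, lowerContent L (U i) + ε := by
        gcongr with i hi
        exact le_lowerContent L (hb0 i K) (hb1 i K)
    _ ≤ ∑' i, lowerContent L (U i) + ε := by
        gcongr
        exact ENNReal.sum_le_tsum _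

/-- **Alexandrov's theorem**: the probability measures on a metric space are weakly sequentially
complete. -/
theorem exists_tendsto_of_tendsto_integral :
    ∃ μ : ProbabilityMeasure X, Tendsto μs atTop (𝓝 μ) := by
  let om : OuterMeasure X := inducedOuterMeasure (fun U (_ : IsOpen U) => lowerContent L U)
    isOpen_empty (lowerContent_empty hL)
  have hP : ∀ ⦃f : ℕ → Set X⦄, (∀ i, IsOpen (f i)) → IsOpen (⋃ i, f i) :=
    fun _ hf => isOpen_iUnion hf
  have hsub : ∀ ⦃f : ℕ → Set X⦄ (hf : ∀ i, IsOpen (f i)),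
      lowerContent L (⋃ i, f i) ≤ ∑' i, lowerContent L (f i) :=
    fun _ hf => lowerContent_iUnion_le hL hf
  have hmono : ∀ ⦃s t : Set X⦄ (_ : IsOpen s) (_ : IsOpen t), s ⊆ t →
      lowerContent L s ≤ lowerContent L t := fun _ _ _ _ h => lowerContent_mono L h
  have hopen : ∀ {U}, IsOpen U → om U = lowerContent L U := fun {U} hU =>
    inducedOuterMeasure_eq' hP hsub hmono hU
  have hmetric : om.IsMetric := by
    rintro A B ⟨r, hr, hAB⟩
    refine le_antisymm (measure_union_le A B) ?_
    -- An open `W` covering `A ∪ B` contains disjoint open neighbourhoods of `A` and `B`, on which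
    -- the content is superadditive.
    refine (le_iInf fun W => le_iInf fun hW => le_iInf fun hABW => ?_).trans
      (inducedOuterMeasure_eq_iInf hP hsub hmono (A ∪ B)).ge
    let e : ℝ≥0∞ := min (r / 2) 1
    have he : 0 < e := lt_min (ENNReal.half_pos hr) one_pos
    have he2 : e + e ≤ r := by
      calc e + e ≤ r / 2 + r / 2 := add_le_add (min_le_left _ _) (min_le_left _ _)
        _ = r := ENNReal.add_halves r
    let U : Set X := W ∩ ⋃ a ∈ A, Metric.eball a e
    let V : Set X := W ∩ ⋃ b ∈ B, Metric.eball b e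
    have hU : IsOpen U := hW.inter (isOpen_biUnion fun _ _ => Metric.isOpen_eball)
    have hV : IsOpen V := hW.inter (isOpen_biUnion fun _ _ => Metric.isOpen_eball)
    have hUV : Disjoint U V := by
      refine Set.disjoint_left.2 ?_
      rintro x ⟨-, hxA⟩ ⟨-, hxB⟩
      simp only [Set.mem_iUnion, exists_prop] at hxA hxB
      obtain ⟨a, ha, hxa⟩ := hxA
      obtain ⟨b, hb, hxb⟩ := hxB
      have : edist a b < e + e := by
        refine (edist_triangle a x b).trans_lt (ENNReal.add_lt_add ?_ hxb)
        rw [edist_comm]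
        exact hxa
      exact absurd (hAB a ha b hb) (not_le.2 (this.trans_le he2))
    calc om A + om B ≤ om U + om V := add_le_add
          (measure_mono fun a ha => ⟨hABW (Or.inl ha), Set.mem_biUnion ha (Metric.mem_eball_self he)⟩)
          (measure_mono fun b hb => ⟨hABW (Or.inr hb), Set.mem_biUnion hb (Metric.mem_eball_self he)⟩)
      _ = lowerContent L U + lowerContent L V := by rw [hopen hU, hopen hV]
      _ ≤ lowerContent L W := lowerContent_add_le hL hUV
          (Set.union_subset Set.inter_subset_left Set.inter_subset_left)
  have hcar : ‹MeasurableSpace X› ≤ om.caratheodory := by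
    rw [BorelSpace.measurable_eq (α := X)]
    exact hmetric.borel_le_caratheodory
  have hmu : ∀ {U}, IsOpen U → om.toMeasure hcar U = lowerContent L U := fun {U} hU => by
    rw [toMeasure_apply _ _ hU.measurableSet, hopen hU]
  refine ⟨⟨om.toMeasure hcar, ⟨?_⟩⟩, tendsto_of_forall_isOpen_le_liminf' fun G hG => ?_⟩
  · rw [hmu isOpen_univ, lowerContent_univ hL]
  · exact (hmu hG).trans_le (lowerContent_le_liminf hL hG)

end

end WeakLimit

/-! ### Von Neumann's mean ergodic theorem for a seminorm. -/

section MeanErgodic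

/-- The averages `(1 / n) ∑_{k < n} T ^ k` of a linear operator. -/
noncomputable def cesaroMean {E : Type*} [AddCommGroup E] [Module ℝ E] (T : E →ₗ[ℝ] E) (n : ℕ) :
    E →ₗ[ℝ] E :=
  (n : ℝ)⁻¹ • ∑ k ∈ Finset.range n, T ^ k

theorem cesaroMean_apply {E : Type*} [AddCommGroup E] [Module ℝ E] (T : E →ₗ[ℝ] E) (n : ℕ)
    (x : E) : cesaroMean T n x = (n : ℝ)⁻¹ • ∑ k ∈ Finset.range n, (T ^ k) x := by
  simp [cesaroMean]

theorem cesaroMean_eq_birkhoffAverage {E : Type*} [AddCommGroup E] [Module ℝ E]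
    (T : E →ₗ[ℝ] E) (n : ℕ) (x : E) : cesaroMean T n x = birkhoffAverage ℝ T id n x := by
  simp [cesaroMean_apply, birkhoffAverage, birkhoffSum, Module.End.pow_apply]

/-- The mean ergodic theorem for a contraction of a space with a semidefinite inner product. -/
theorem exists_forall_inner_cesaroMean_sub_le {E : Type*} [AddCommGroup E] [Module ℝ E]
    (c : PreInnerProductSpace.Core ℝ E) (T : E →ₗ[ℝ] E)
    (hT : ∀ x, c.inner (T x) (T x) ≤ c.inner x x) (x : E) {η : ℝ} (hη : 0 < η) :
    ∃ N, ∀ n ≥ N, ∀ m ≥ N, c.inner (cesaroMean T n x - cesaroMean T m x)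
      (cesaroMean T n x - cesaroMean T m x) ≤ η := by
  let : SeminormedAddCommGroup E :=
    @InnerProductSpace.Core.toSeminormedAddCommGroup ℝ E _ _ _ c
  let : InnerProductSpace ℝ E := InnerProductSpace.ofCore c
  have hin : ∀ y : E, c.inner y y = ‖y‖ ^ 2 := fun y => (real_inner_self_eq_norm_sq y)
  have hT' : ∀ y, ‖T y‖ ≤ 1 * ‖y‖ := fun y => by
    have := hT y
    rw [hin, hin] at this
    rw [one_mul]
    exact le_of_sq_le_sq this (norm_nonneg _)
  -- The completion is a genuine Hilbert space, to which the contraction extends. The Cauchy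
  -- property is then pulled back along the isometric map into it.
  let f : E →L[ℝ] E := T.mkContinuous 1 hT'
  have hf : ‖f.completion‖ ≤ 1 := by
    refine ContinuousLinearMap.opNorm_le_bound _ zero_le_one fun y => ?_
    induction y using UniformSpace.Completion.induction_on with
    | hp =>
      exact isClosed_le f.completion.continuous.norm (continuous_const.mul continuous_norm)
    | ih y =>
      rw [ContinuousLinearMap.completion_apply_coe, UniformSpace.Completion.norm_coe,
        UniformSpace.Completion.norm_coe]
      exact hT' y
  have hlim := (f.completion.tendsto_birkhoffAverage_orthogonalProjection hf
    (x : UniformSpace.Completion E)).cauchySeq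
  have hcoe : ∀ n, birkhoffAverage ℝ f.completion id n (x : UniformSpace.Completion E) =
      ((cesaroMean T n x : E) : UniformSpace.Completion E) := by
    intro n
    have hk : ∀ k, f.completion^[k] (x : UniformSpace.Completion E) =
        (((T ^ k) x : E) : UniformSpace.Completion E) := by
      intro k
      induction k with
      | zero => simp
      | succ k ih =>
        rw [Function.iterate_succ_apply', ih, ContinuousLinearMap.completion_apply_coe, pow_succ']
        rfl
    rw [cesaroMean_apply, birkhoffAverage, birkhoffSum, UniformSpace.Completion.coe_smul]
    congr 1
    simp only [id, hk]
    exact (map_sum (UniformSpace.Completion.toComplL (𝕜 := ℝ) (E := E)) _ _).symm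
  simp_rw [hcoe] at hlim
  obtain ⟨N, hN⟩ := Metric.cauchySeq_iff.1 hlim (Real.sqrt η) (Real.sqrt_pos.2 hη)
  refine ⟨N, fun n hn m hm => ?_⟩
  have := hN n hn m hm
  rw [UniformSpace.Completion.dist_eq, dist_eq_norm] at this
  rw [hin, ← Real.sq_sqrt hη.le]
  exact pow_le_pow_left₀ (norm_nonneg _) this.le 2

end MeanErgodic

/-! ### Pointwise convergence of Cesàro means of a Markov operator. -/

section InvariantMean

variable {X : Type*} [TopologicalSpace X] {T : (X →ᵇ ℝ) →ₗ[ℝ] (X →ᵇ ℝ)}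

section

variable (h1 : T 1 = 1) (hT : ∀ f : X →ᵇ ℝ, 0 ≤ f → 0 ≤ T f)

include h1 hT

theorem norm_markov_le (f : X →ᵇ ℝ) : ‖T f‖ ≤ ‖f‖ := by
  refine (BoundedContinuousFunction.norm_le (norm_nonneg f)).2 fun x => ?_
  have hb : ∀ y, |f y| ≤ ‖f‖ := f.norm_coe_le_norm
  have e1 := hT (‖f‖ • 1 - f) fun y => by
    change 0 ≤ ‖f‖ * 1 - f y
    linarith [(abs_le.1 (hb y)).2]
  have e2 := hT (‖f‖ • 1 + f) fun y => by
    change 0 ≤ ‖f‖ * 1 + f y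
    linarith [(abs_le.1 (hb y)).1]
  rw [map_sub, map_smul, h1] at e1
  rw [map_add, map_smul, h1] at e2
  have e1 : 0 ≤ ‖f‖ * 1 - T f x := e1 x
  have e2 : 0 ≤ ‖f‖ * 1 + T f x := e2 x
  rw [Real.norm_eq_abs, abs_le]
  constructor <;> linarith

theorem norm_markov_pow_le (k : ℕ) (f : X →ᵇ ℝ) : ‖(T ^ k) f‖ ≤ ‖f‖ := by
  induction k with
  | zero => simp
  | succ k ih =>
    rw [pow_succ']
    exact (norm_markov_le h1 hT _).trans ih

theorem norm_cesaroMean_le (n : ℕ) (f : X →ᵇ ℝ) : ‖cesaroMean T n f‖ ≤ ‖f‖ := by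
  rw [cesaroMean_apply, norm_smul, norm_inv, Real.norm_natCast]
  have : ‖∑ k ∈ Finset.range n, (T ^ k) f‖ ≤ n * ‖f‖ := by
    refine (norm_sum_le _ _).trans ?_
    calc ∑ k ∈ Finset.range n, ‖(T ^ k) f‖ ≤ ∑ k ∈ Finset.range n, ‖f‖ :=
          Finset.sum_le_sum fun k _ => norm_markov_pow_le h1 hT k f
      _ = n * ‖f‖ := by simp
  rcases n.eq_zero_or_pos with rfl | hn
  · simp
  · rw [inv_mul_le_iff₀ (by exact_mod_cast hn)]
    exact this

/-- Jensen's inequality: apply `T` to the square of `f - T f x` and evaluate at `x`. -/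
theorem markov_sq_le (f : X →ᵇ ℝ) (x : X) : (T f * T f) x ≤ T (f * f) x := by
  have e := hT ((f - (T f x) • 1) * (f - (T f x) • 1)) fun y => mul_self_nonneg _
  have e' : (f - (T f x) • 1) * (f - (T f x) • 1) =
      f * f - (2 * T f x) • f + (T f x * T f x) • 1 := by
    ext y
    simp
    ring
  rw [e', map_add, map_sub, map_smul, map_smul, h1] at e
  have : 0 ≤ T (f * f) x - 2 * T f x * T f x + T f x * T f x * 1 := e x
  rw [BoundedContinuousFunction.coe_mul, Pi.mul_apply]
  linarith

/-- The means are bounded by `‖f‖`, so they converge along an ultrafilter. Using the same one for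
all `f` makes the limit linear. -/
theorem exists_linearMap_tendsto_cesaroMean (z : X) :
    ∃ Λ : (X →ᵇ ℝ) →ₗ[ℝ] ℝ, ∀ f, Tendsto (fun n => cesaroMean T n f z)
      (hyperfilter ℕ : Filter ℕ) (𝓝 (Λ f)) := by
  have hex : ∀ f : X →ᵇ ℝ, ∃ l, Tendsto (fun n => cesaroMean T n f z)
      (hyperfilter ℕ : Filter ℕ) (𝓝 l) := by
    intro f
    have hmem : Set.Icc (-‖f‖) ‖f‖ ∈ (hyperfilter ℕ).map (fun n => cesaroMean T n f z) :=
      Filter.mem_map.2 <| Filter.univ_mem' fun n => abs_le.1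
        (((cesaroMean T n f).norm_coe_le_norm z).trans (norm_cesaroMean_le h1 hT n f))
    obtain ⟨l, -, hl⟩ := isCompact_Icc.ultrafilter_le_nhds
      ((hyperfilter ℕ).map (fun n => cesaroMean T n f z)) (le_principal_iff.2 hmem)
    exact ⟨l, hl⟩
  choose Λ hΛ using hex
  refine ⟨⟨⟨Λ, fun f g => ?_⟩, fun r f => ?_⟩, hΛ⟩
  · refine tendsto_nhds_unique (hΛ _) (((hΛ f).add (hΛ g)).congr fun n => ?_)
    rw [map_add]
    rfl
  · refine tendsto_nhds_unique (hΛ _) (((hΛ f).const_mul r).congr fun n => ?_)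
    rw [map_smul]
    rfl

/-- If two means differ by `r` at `z`, equicontinuity keeps them `r / 2` apart on some `B`, and the
recurrence to `B` bounds the squared seminorm of their difference below by `(r / 2) ^ 2 * δ`. The
mean ergodic theorem makes it at most half of that. -/
theorem cauchySeq_cesaroMean_apply {z : X} {𝓑 : Set (Set X)}
    (heq : ∀ f : X →ᵇ ℝ, ∀ η > 0, ∃ B ∈ 𝓑, ∀ y ∈ B, ∀ k, |(T ^ k) f y - (T ^ k) f z| ≤ η)
    (hlow : ∀ B ∈ 𝓑, ∃ δ > 0, ∀ g : X →ᵇ ℝ, ∀ c ≥ 0, 0 ≤ g → (∀ y ∈ B, c ≤ g y) →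
      ∀ᶠ k in atTop, c * δ ≤ (T ^ k) g z) (f : X →ᵇ ℝ) :
    CauchySeq fun n => cesaroMean T n f z := by
  obtain ⟨Λ, hΛ⟩ := exists_linearMap_tendsto_cesaroMean h1 hT z
  have hpow : ∀ k (g : X →ᵇ ℝ), 0 ≤ g → 0 ≤ (T ^ k) g := by
    intro k g hg
    induction k with
    | zero => simpa
    | succ k ih =>
      rw [pow_succ']
      exact hT _ ih
  have hpos : ∀ g : X →ᵇ ℝ, 0 ≤ g → 0 ≤ Λ g := fun g hg =>
    ge_of_tendsto' (hΛ g) fun n => by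
      rw [cesaroMean_apply]
      simp only [BoundedContinuousFunction.coe_smul, BoundedContinuousFunction.coe_sum,
        Finset.sum_apply, smul_eq_mul]
      exact mul_nonneg (by positivity) (Finset.sum_nonneg fun k _ => hpow k g hg z)
  have hinv : ∀ g, Λ (T g) = Λ g := by
    intro g
    have hb : Bornology.IsBounded (Set.range (id <| T^[·] g)) :=
      isBounded_iff_forall_norm_le.2 ⟨‖g‖, Set.forall_mem_range.2 fun n => by
        simpa [Module.End.pow_apply] using norm_markov_pow_le h1 hT n g⟩
    have h := tendsto_birkhoffAverage_apply_sub_birkhoffAverage (f := T) (g := id) ℝ hb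
    have h' : Tendsto (fun n => (cesaroMean T n (T g) - cesaroMean T n g) z) atTop (𝓝 0) := by
      simp only [cesaroMean_eq_birkhoffAverage]
      simpa [Function.comp_def] using ((BoundedContinuousFunction.evalCLM ℝ z).continuous.tendsto _).comp h
    have h2 := h'.mono_left (Nat.hyperfilter_le_atTop)
    exact sub_eq_zero.1 (tendsto_nhds_unique ((hΛ (T g)).sub (hΛ g)) h2)
  let c : PreInnerProductSpace.Core ℝ (X →ᵇ ℝ) :=
    { inner := fun f g => Λ (f * g)
      conj_inner_symm := fun f g => by simp [mul_comm]
      re_inner_nonneg := fun f => hpos _ fun x => mul_self_nonneg (f x)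
      add_left := fun f g h => by rw [add_mul, map_add]
      smul_left := fun f g r => by rw [smul_mul_assoc, map_smul]; rfl }
  have hcontr : ∀ g, c.inner (T g) (T g) ≤ c.inner g g := by
    intro g
    change Λ (T g * T g) ≤ Λ (g * g)
    rw [← hinv (g * g), ← sub_nonneg, ← map_sub]
    exact hpos _ fun x => sub_nonneg.2 (markov_sq_le h1 hT g x)
  refine Metric.cauchySeq_iff.2 fun r hr => ?_
  obtain ⟨B, hB, hBη⟩ := heq f (r / 4) (by positivity)
  obtain ⟨δ, hδ, hlowB⟩ := hlow B hB
  obtain ⟨N, hN⟩ := exists_forall_inner_cesaroMean_sub_le c T hcontr f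
    (η := (r / 2) ^ 2 * δ / 2) (by positivity)
  refine ⟨N, fun n hn m hm => ?_⟩
  by_contra hcon
  rw [not_lt, Real.dist_eq] at hcon
  have hav : ∀ n, ∀ y ∈ B, |cesaroMean T n f y - cesaroMean T n f z| ≤ r / 4 := by
    intro n y hy
    rw [cesaroMean_apply]
    simp only [BoundedContinuousFunction.coe_smul, BoundedContinuousFunction.coe_sum,
      Finset.sum_apply, smul_eq_mul]
    rw [← mul_sub, ← Finset.sum_sub_distrib, abs_mul, abs_inv, Nat.abs_cast]
    have : |∑ k ∈ Finset.range n, ((T ^ k) f y - (T ^ k) f z)| ≤ n * (r / 4) := by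
      refine (Finset.abs_sum_le_sum_abs _ _).trans ?_
      calc _ ≤ ∑ k ∈ Finset.range n, r / 4 := Finset.sum_le_sum fun k _ => hBη y hy k
        _ = n * (r / 4) := by simp
    rcases n.eq_zero_or_pos with rfl | hn
    · simpa using by positivity
    · rw [inv_mul_le_iff₀ (by exact_mod_cast hn)]
      exact this
  let d := cesaroMean T n f - cesaroMean T m f
  have hd : ∀ y ∈ B, (r / 2) ^ 2 ≤ (d * d) y := by
    intro y hy
    have e1 := hav n y hy
    have e2 := hav m y hy
    have e3 : r / 2 ≤ |cesaroMean T n f y - cesaroMean T m f y| := by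
      have := abs_sub_abs_le_abs_sub (cesaroMean T n f z - cesaroMean T m f z)
        (cesaroMean T n f y - cesaroMean T m f y)
      have e4 : |(cesaroMean T n f z - cesaroMean T m f z) -
        (cesaroMean T n f y - cesaroMean T m f y)| ≤ r / 4 + r / 4 := by
        refine (le_of_eq ?_).trans ((abs_sub _ _).trans (add_le_add e2 e1))
        congr 1
        ring
      linarith
    calc (r / 2) ^ 2 ≤ |cesaroMean T n f y - cesaroMean T m f y| ^ 2 :=
          pow_le_pow_left₀ (by positivity) e3 2
      _ = (d * d) y := by
          rw [sq_abs, sq]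
          rfl
  have hev := hlowB (d * d) ((r / 2) ^ 2) (by positivity) (fun x => mul_self_nonneg (d x)) hd
  -- Truncation makes the sequence eventually constant, so its Cesàro limit is known and bounds `Λ
  -- (d * d)` from below.
  have hces : Tendsto (fun n : ℕ => (n : ℝ)⁻¹ * ∑ k ∈ Finset.range n,
      min ((T ^ k) (d * d) z) ((r / 2) ^ 2 * δ)) atTop (𝓝 ((r / 2) ^ 2 * δ)) := by
    refine Filter.Tendsto.cesaro (tendsto_const_nhds.congr' ?_)
    filter_upwards [hev] with k hk
    rw [min_eq_right hk]
  have hge : (r / 2) ^ 2 * δ ≤ Λ (d * d) := by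
    refine le_of_tendsto_of_tendsto' (hces.mono_left Nat.hyperfilter_le_atTop) (hΛ (d * d))
      fun n => ?_
    rw [cesaroMean_apply]
    simp only [BoundedContinuousFunction.coe_smul, BoundedContinuousFunction.coe_sum,
      Finset.sum_apply, smul_eq_mul]
    exact mul_le_mul_of_nonneg_left (Finset.sum_le_sum fun k _ => min_le_left _ _) (by positivity)
  have hle : Λ (d * d) ≤ (r / 2) ^ 2 * δ / 2 := hN n hn m hm
  have : 0 < (r / 2) ^ 2 * δ := by positivity
  linarith

end

end InvariantMean

/-! ### Splitting off a fixed fraction of mass. -/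

section Decomposition

variable {X : Type*} [TopologicalSpace X] [MeasurableSpace X] [OpensMeasurableSpace X]

/-- `ν` is `μ` conditioned on `B`. `ρ` normalises what is left: `μ` on `Bᶜ` and the unused
proportion `1 - δ / μ(B)` of `μ` on `B`. -/
theorem ProbabilityMeasure.exists_decomposition (μ : ProbabilityMeasure X) {B : Set X}
    (hB : MeasurableSet B) {δ : ℝ} (h0 : 0 < δ) (h1 : δ < 1) (hδ : δ ≤ (μ : Measure X).real B) :
    ∃ ν ρ : ProbabilityMeasure X, (∀ᵐ x ∂(ν : Measure X), x ∈ B) ∧ ∀ g : X →ᵇ ℝ,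
      ∫ x, g x ∂(μ : Measure X) =
        δ * ∫ x, g x ∂(ν : Measure X) + (1 - δ) * ∫ x, g x ∂(ρ : Measure X) := by
  set b := (μ : Measure X).real B with hb
  have hb0 : 0 < b := h0.trans_le hδ
  have hb1 : b + (μ : Measure X).real Bᶜ = 1 := probReal_add_probReal_compl hB
  have hc : 0 ≤ 1 - δ / b := sub_nonneg.2 ((div_le_one hb0).2 hδ)
  have hd : 0 ≤ (1 - δ)⁻¹ := inv_nonneg.2 (by linarith)
  have hd' : 1 - δ ≠ 0 := by linarith
  let ν : Measure X := ENNReal.ofReal b⁻¹ • (μ : Measure X).restrict B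
  let ρ : Measure X := ENNReal.ofReal (1 - δ)⁻¹ •
    ((μ : Measure X).restrict Bᶜ + ENNReal.ofReal (1 - δ / b) • (μ : Measure X).restrict B)
  have hBe : (μ : Measure X) B = ENNReal.ofReal b := by simp [hb]
  have hBce : (μ : Measure X) Bᶜ = ENNReal.ofReal (1 - b) := by
    rw [← hb1, add_sub_cancel_left]
    simp
  have hbl : 0 ≤ 1 - b := by linarith [measureReal_nonneg (μ := (μ : Measure X)) (s := Bᶜ)]
  have hν : IsProbabilityMeasure ν := ⟨by
    simp only [ν, Measure.smul_apply, Measure.restrict_apply_univ, smul_eq_mul, hBe]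
    rw [← ENNReal.ofReal_mul (by positivity), inv_mul_cancel₀ hb0.ne', ENNReal.ofReal_one]⟩
  have hρ : IsProbabilityMeasure ρ := ⟨by
    simp only [ρ, Measure.smul_apply, Measure.add_apply, Measure.restrict_apply_univ, smul_eq_mul,
      hBe, hBce]
    rw [← ENNReal.ofReal_mul hc, ← ENNReal.ofReal_add hbl (by positivity),
      ← ENNReal.ofReal_mul hd, ← ENNReal.ofReal_one]
    congr 1
    field_simp
    ring⟩
  refine ⟨⟨ν, hν⟩, ⟨ρ, hρ⟩, ?_, fun g => ?_⟩
  · exact (Measure.smul_absolutelyContinuous).ae_le (ae_restrict_mem hB)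
  · change _ = δ * ∫ x, g x ∂ν + (1 - δ) * ∫ x, g x ∂ρ
    have hi : ∀ A : Set X, Integrable (fun x => g x) ((μ : Measure X).restrict A) := fun A =>
      (g.integrable _).restrict
    have e : ∫ x, g x ∂(μ : Measure X) =
        ∫ x in B, g x ∂(μ : Measure X) + ∫ x in Bᶜ, g x ∂(μ : Measure X) :=
      (integral_add_compl hB (g.integrable _)).symm
    simp only [ν, ρ]
    rw [e, integral_smul_measure, integral_smul_measure,
      integral_add_measure (hi _) ((hi _).smul_measure ENNReal.ofReal_ne_top),
      integral_smul_measure, ENNReal.toReal_ofReal hd, ENNReal.toReal_ofReal hc,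
      ENNReal.toReal_ofReal (by positivity)]
    simp only [smul_eq_mul]
    field_simp
    ring

theorem ProbabilityMeasure.abs_integral_sub_le {ν : ProbabilityMeasure X} {B : Set X}
    (hν : ∀ᵐ x ∂(ν : Measure X), x ∈ B) {g : X →ᵇ ℝ} {a η : ℝ} (hg : ∀ x ∈ B, |g x - a| ≤ η) :
    |∫ x, g x ∂(ν : Measure X) - a| ≤ η := by
  have e : ∫ x, g x ∂(ν : Measure X) - a = ∫ x, (g x - a) ∂(ν : Measure X) := by
    rw [integral_sub (g.integrable _) (integrable_const _)]
    simp
  rw [e, ← Real.norm_eq_abs]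
  simpa using norm_integral_le_of_norm_le_const (f := fun x => g x - a) (C := η)
    (hν.mono fun x hx => hg x hx)

end Decomposition

/-! ### Sufficiency of the lower bound condition. -/

namespace FellerSemigroup

variable {X : Type*} [MetricSpace X] [MeasurableSpace X] [BorelSpace X] (S : FellerSemigroup X)

/-- The Dirac measure as an element of the space of probability measures. -/
noncomputable def diracPM (x : X) : ProbabilityMeasure X := ⟨Measure.dirac x, inferInstance⟩

theorem op_eq_integral (t : ℝ≥0) (φ : BoundedBorel X) (x : X) :
    (S.op t φ).1 x = ∫ y, φ.1 y ∂(S.dual t (diracPM x) : Measure X) := by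
  rw [← S.duality]
  exact (integral_dirac _ _).symm

/-- The operator `P_t` on `C_b(X)`. -/
noncomputable def opCb (t : ℝ≥0) : (X →ᵇ ℝ) →ₗ[ℝ] (X →ᵇ ℝ) where
  toFun f := BoundedContinuousFunction.ofNormedAddCommGroup
    (S.op t (BoundedBorel.ofCb f)).1 (S.feller t f) ‖f‖ fun x => by
      rw [op_eq_integral]
      exact f.norm_integral_le_norm _
  map_add' f g := by
    ext x
    have : BoundedBorel.ofCb (f + g) = BoundedBorel.ofCb f + BoundedBorel.ofCb g := rfl
    change (S.op t (BoundedBorel.ofCb (f + g))).1 x = _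
    rw [this, map_add]
    rfl
  map_smul' r f := by
    ext x
    have : BoundedBorel.ofCb (r • f) = r • BoundedBorel.ofCb f := rfl
    change (S.op t (BoundedBorel.ofCb (r • f))).1 x = _
    rw [this, map_smul]
    rfl

theorem opCb_apply (t : ℝ≥0) (f : X →ᵇ ℝ) (x : X) :
    S.opCb t f x = ∫ y, f y ∂(S.dual t (diracPM x) : Measure X) :=
  S.op_eq_integral t (BoundedBorel.ofCb f) x

theorem integral_opCb (t : ℝ≥0) (f : X →ᵇ ℝ) (μ : ProbabilityMeasure X) :
    ∫ x, S.opCb t f x ∂(μ : Measure X) = ∫ x, f x ∂(S.dual t μ : Measure X) :=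
  S.duality t (BoundedBorel.ofCb f) μ

theorem opCb_pow (k : ℕ) (f : X →ᵇ ℝ) : ((S.opCb 1) ^ k) f = S.opCb k f := by
  induction k with
  | zero =>
    ext x
    change f x = (S.op ((0 : ℕ) : ℝ≥0) (BoundedBorel.ofCb f)).1 x
    rw [Nat.cast_zero, S.op_zero]
    rfl
  | succ k ih =>
    rw [pow_succ', Module.End.mul_apply, ih]
    ext x
    change _ = (S.op ((k + 1 : ℕ) : ℝ≥0) (BoundedBorel.ofCb f)).1 x
    rw [Nat.cast_succ, add_comm, S.op_add]
    rfl

theorem opCb_one (t : ℝ≥0) : S.opCb t 1 = 1 := by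
  ext x
  rw [opCb_apply]
  simp

theorem opCb_nonneg (t : ℝ≥0) {f : X →ᵇ ℝ} (hf : 0 ≤ f) : 0 ≤ S.opCb t f := fun x => by
  change 0 ≤ S.opCb t f x
  rw [opCb_apply]
  exact integral_nonneg hf

/-- The integrand is `P_t` of the indicator of `A`, an element of `B_b(X)`, and the identity is
duality. -/
theorem measurable_dual_dirac_and_lintegral_eq (t : ℝ≥0) (μ : ProbabilityMeasure X) {A : Set X} (hA : MeasurableSet A) :
    Measurable (fun x => (S.dual t (diracPM x) : Measure X) A) ∧
    ∫⁻ x, (S.dual t (diracPM x) : Measure X) A ∂(μ : Measure X) =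
      (S.dual t μ : Measure X) A := by
  let φ : BoundedBorel X := ⟨A.indicator (fun _ => 1), measurable_const.indicator hA, 1, fun x => by
    by_cases hx : x ∈ A <;> simp [hx]⟩
  have hφ : ∀ ν : ProbabilityMeasure X, ∫ x, φ.1 x ∂(ν : Measure X) = (ν : Measure X).real A :=
    fun ν => by simp [φ, integral_indicator_const (1 : ℝ) hA]
  have hop : ∀ x, (S.dual t (diracPM x) : Measure X) A = ENNReal.ofReal ((S.op t φ).1 x) :=
    fun x => by
      rw [op_eq_integral, hφ]
      simp
  have hm : Measurable (S.op t φ).1 := (S.op t φ).2.1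
  simp_rw [hop]
  refine ⟨hm.ennreal_ofReal, ?_⟩
  obtain ⟨C, hC⟩ := (S.op t φ).2.2
  rw [← ofReal_integral_eq_lintegral_ofReal, S.duality, hφ]
  · simp
  · exact Integrable.of_bound hm.aestronglyMeasurable C (ae_of_all _ hC)
  · exact ae_of_all _ (S.op_nonneg t φ fun x => Set.indicator_nonneg (fun _ _ => zero_le_one) x)

/-- The lower bound on the balls around `z`, for arbitrary initial distributions. -/
theorem exists_eventually_le_dual_real {z : X} (hz : ∀ ε : ℝ, 0 < ε →
    0 < ⨅ x : X, liminf (fun t : ℝ≥0 => (S.dual t (diracPM x) : Measure X) (Metric.ball z ε)) atTop)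
    {ε : ℝ} (hε : 0 < ε) : ∃ δ : ℝ, 0 < δ ∧ δ < 1 ∧ ∀ μ : ProbabilityMeasure X,
      ∀ᶠ k : ℕ in atTop, δ ≤ (S.dual k μ : Measure X).real (Metric.ball z ε) := by
  -- The cap at `1` gives `δ < 1`, needed to normalise the remainder of the decomposition. Fatou's
  -- lemma then passes from Dirac masses to `μ`.
  obtain ⟨δ, hδ0, hδ⟩ := ENNReal.lt_iff_exists_nnreal_btwn.1
    (lt_min (hz ε hε) (one_pos (α := ℝ≥0∞)))
  refine ⟨δ, by exact_mod_cast hδ0, by exact_mod_cast hδ.trans_le (min_le_right _ _),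
    fun μ => ?_⟩
  have hB : MeasurableSet (Metric.ball z ε) := Metric.isOpen_ball.measurableSet
  have hlt : (δ : ℝ≥0∞) <
      liminf (fun k : ℕ => (S.dual k μ : Measure X) (Metric.ball z ε)) atTop := by
    refine (hδ.trans_le (min_le_left _ _)).trans_le ?_
    calc _ = ∫⁻ _, (⨅ x : X, liminf (fun t : ℝ≥0 =>
            (S.dual t (diracPM x) : Measure X) (Metric.ball z ε)) atTop) ∂(μ : Measure X) := by simp
      _ ≤ ∫⁻ x, liminf (fun k : ℕ =>
            (S.dual k (diracPM x) : Measure X) (Metric.ball z ε)) atTop ∂(μ : Measure X) := by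
          refine lintegral_mono fun x => (iInf_le _ x).trans ?_
          exact liminf_le_liminf_of_le (tendsto_natCast_atTop_atTop (R := ℝ≥0))
      _ ≤ liminf (fun k : ℕ => ∫⁻ x, (S.dual k (diracPM x) : Measure X) (Metric.ball z ε)
            ∂(μ : Measure X)) atTop := lintegral_liminf_le fun k => (S.measurable_dual_dirac_and_lintegral_eq k μ hB).1
      _ = _ := by simp_rw [(S.measurable_dual_dirac_and_lintegral_eq _ μ hB).2]
  filter_upwards [eventually_lt_of_lt_liminf hlt] with k hk
  have := (ENNReal.toReal_le_toReal ENNReal.coe_ne_top (measure_ne_top _ _)).2 hk.le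
  rwa [ENNReal.coe_toReal] at this

theorem tendsto_integral_dual_sub (hS : S.EPropertyCb) {z : X} (hz : ∀ ε : ℝ, 0 < ε →
    0 < ⨅ x : X, liminf (fun t : ℝ≥0 => (S.dual t (diracPM x) : Measure X) (Metric.ball z ε)) atTop)
    (f : X →ᵇ ℝ) (μ ν : ProbabilityMeasure X) :
    Tendsto (fun t : ℝ≥0 => ∫ x, f x ∂(S.dual t μ : Measure X) -
      ∫ x, f x ∂(S.dual t ν : Measure X)) atTop (𝓝 0) := by
  refine Metric.tendsto_nhds.2 fun r hr => ?_
  obtain ⟨ε, hε, hball⟩ := Metric.eventually_nhds_iff_ball.1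
    (Metric.equicontinuousAt_iff_right.1 (hS f z) (r / 4) (by positivity))
  have hball : ∀ y ∈ Metric.ball z ε, ∀ t, |S.opCb t f y - S.opCb t f z| ≤ r / 4 :=
    fun y hy t => by
      have := (hball y hy t).le
      rwa [dist_comm] at this
  obtain ⟨δ, hδ0, hδ1, hδ⟩ := S.exists_eventually_le_dual_real hz hε
  have key : ∀ n : ℕ, ∀ μ ν : ProbabilityMeasure X, ∀ᶠ t : ℝ≥0 in atTop,
      |∫ x, f x ∂(S.dual t μ : Measure X) - ∫ x, f x ∂(S.dual t ν : Measure X)| ≤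
        r / 2 + (1 - δ) ^ n * (2 * ‖f‖) := by
    intro n
    induction n with
    | zero =>
      intro μ ν
      refine Eventually.of_forall fun t => ?_
      have h1 := f.norm_integral_le_norm (S.dual t μ : Measure X)
      have h2 := f.norm_integral_le_norm (S.dual t ν : Measure X)
      have h3 := norm_sub_le (∫ x, f x ∂(S.dual t μ : Measure X))
        (∫ x, f x ∂(S.dual t ν : Measure X))
      rw [← Real.norm_eq_abs]
      linarith
    | succ n ih =>
      intro μ ν
      -- `δ` does not depend on the measure, so both distributions can be split at a common time and
      -- the remainders fed to the induction hypothesis.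
      obtain ⟨k, hkμ, hkν⟩ := ((hδ μ).and (hδ ν)).exists
      have hB : MeasurableSet (Metric.ball z ε) := Metric.isOpen_ball.measurableSet
      obtain ⟨μ₁, μ₂, hμ₁, hμ⟩ :=
        ProbabilityMeasure.exists_decomposition (S.dual k μ) hB hδ0 hδ1 hkμ
      obtain ⟨ν₁, ν₂, hν₁, hν⟩ :=
        ProbabilityMeasure.exists_decomposition (S.dual k ν) hB hδ0 hδ1 hkν
      have hsh : ∀ᶠ t : ℝ≥0 in atTop,
          |∫ x, f x ∂(S.dual (t + k) μ : Measure X) - ∫ x, f x ∂(S.dual (t + k) ν : Measure X)| ≤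
            r / 2 + (1 - δ) ^ (n + 1) * (2 * ‖f‖) := by
        filter_upwards [ih μ₂ ν₂] with t ht
        rw [S.dual_add, S.dual_add, ← S.integral_opCb t f (S.dual k μ),
          ← S.integral_opCb t f (S.dual k ν), hμ, hν, S.integral_opCb t f μ₂,
          S.integral_opCb t f ν₂]
        have h1 := abs_le.1 (ProbabilityMeasure.abs_integral_sub_le hμ₁ fun x hx => hball x hx t)
        have h2 := abs_le.1 (ProbabilityMeasure.abs_integral_sub_le hν₁ fun x hx => hball x hx t)
        have h3 := abs_le.1 ht
        have h4 : 0 ≤ 1 - δ := by linarith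
        rw [pow_succ', abs_le]
        generalize (∫ x, S.opCb t f x ∂(μ₁ : Measure X)) = a₁ at *
        generalize (∫ x, S.opCb t f x ∂(ν₁ : Measure X)) = b₁ at *
        generalize (∫ x, f x ∂(S.dual t μ₂ : Measure X)) = a₂ at *
        generalize (∫ x, f x ∂(S.dual t ν₂ : Measure X)) = b₂ at *
        -- The error does not accumulate: `δ * (r / 2) + (1 - δ) * (r / 2) = r / 2`.
        have u1 : δ * (a₁ - b₁) ≤ δ * (r / 2) := mul_le_mul_of_nonneg_left (by linarith) hδ0.le
        have u2 : δ * (b₁ - a₁) ≤ δ * (r / 2) := mul_le_mul_of_nonneg_left (by linarith) hδ0.le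
        have u3 := mul_le_mul_of_nonneg_left h3.1 h4
        have u4 := mul_le_mul_of_nonneg_left h3.2 h4
        constructor <;> nlinarith
      obtain ⟨t₀, ht₀⟩ := eventually_atTop.1 hsh
      refine eventually_atTop.2 ⟨t₀ + k, fun t ht => ?_⟩
      have h1 : (k : ℝ≥0) ≤ t := le_add_self.trans ht
      have := ht₀ (t - k) (le_tsub_of_add_le_right ht)
      rwa [tsub_add_cancel_of_le h1] at this
  have hlim : Tendsto (fun n : ℕ => (1 - δ) ^ n * (2 * ‖f‖)) atTop (𝓝 0) := by
    simpa using (tendsto_pow_atTop_nhds_zero_of_lt_one (by linarith)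
      (by linarith : 1 - δ < 1)).mul_const (2 * ‖f‖)
  obtain ⟨n, hn⟩ := (hlim.eventually (gt_mem_nhds (show (0 : ℝ) < r / 2 by positivity))).exists
  filter_upwards [key n μ ν] with t ht
  rw [Real.dist_eq, sub_zero]
  linarith

/-- The Cesàro averages of the distributions at integer times. -/
noncomputable def averagedDual (μ : ProbabilityMeasure X) (n : ℕ) : ProbabilityMeasure X :=
  ⟨((n + 1 : ℕ) : ℝ≥0∞)⁻¹ • ∑ k ∈ Finset.range (n + 1), (S.dual k μ : Measure X), ⟨by
    simp only [Measure.smul_apply, Measure.coe_finsetSum, Finset.sum_apply, measure_univ,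
      Finset.sum_const, Finset.card_range, smul_eq_mul, nsmul_eq_mul, mul_one]
    exact ENNReal.inv_mul_cancel (by simp) (by simp)⟩⟩

theorem integral_averagedDual (μ : ProbabilityMeasure X) (n : ℕ) (f : X →ᵇ ℝ) :
    ∫ x, f x ∂(S.averagedDual μ n : Measure X) =
      ((n + 1 : ℕ) : ℝ)⁻¹ * ∑ k ∈ Finset.range (n + 1), ∫ x, f x ∂(S.dual k μ : Measure X) := by
  change ∫ x, f x ∂(((n + 1 : ℕ) : ℝ≥0∞)⁻¹ •
    ∑ k ∈ Finset.range (n + 1), (S.dual k μ : Measure X)) = _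
  rw [integral_smul_measure, integral_finsetSum_measure fun k _ => f.integrable _,
    ENNReal.toReal_inv, ENNReal.toReal_natCast, smul_eq_mul]

theorem exists_tendsto_averagedDual (hS : S.EPropertyCb) {z : X} (hz : ∀ ε : ℝ, 0 < ε →
    0 < ⨅ x : X, liminf (fun t : ℝ≥0 => (S.dual t (diracPM x) : Measure X) (Metric.ball z ε))
      atTop) :
    ∃ μ, Tendsto (S.averagedDual (diracPM z)) atTop (𝓝 μ) := by
  have hc : ∀ f : X →ᵇ ℝ, CauchySeq fun n => cesaroMean (S.opCb 1) n f z := by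
    refine cauchySeq_cesaroMean_apply (S.opCb_one 1) (fun f => S.opCb_nonneg 1)
      (𝓑 := {B | ∃ ε > 0, B = Metric.ball z ε}) (fun f η hη => ?_) ?_
    · obtain ⟨ε, hε, hball⟩ := Metric.eventually_nhds_iff_ball.1
        (Metric.equicontinuousAt_iff_right.1 (hS f z) η hη)
      refine ⟨_, ⟨ε, hε, rfl⟩, fun y hy k => ?_⟩
      have := (hball y hy k).le
      rw [dist_comm] at this
      rwa [S.opCb_pow]
    · rintro _ ⟨ε, hε, rfl⟩
      obtain ⟨δ, hδ0, hδ1, hδ⟩ := S.exists_eventually_le_dual_real hz hε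
      refine ⟨δ, hδ0, fun g c hc hg hgc => ?_⟩
      filter_upwards [hδ (diracPM z)] with k hk
      rw [S.opCb_pow, S.opCb_apply]
      have hB : MeasurableSet (Metric.ball z ε) := Metric.isOpen_ball.measurableSet
      calc c * δ ≤ c * (S.dual k (diracPM z) : Measure X).real (Metric.ball z ε) := by gcongr
        _ = ∫ x, (Metric.ball z ε).indicator (fun _ => c) x
              ∂(S.dual k (diracPM z) : Measure X) := by
            rw [integral_indicator_const c hB, smul_eq_mul, mul_comm]
        _ ≤ _ := by
            refine integral_mono ((integrable_const c).indicator hB) (g.integrable _) fun x => ?_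
            by_cases hx : x ∈ Metric.ball z ε
            · simpa only [Set.indicator_of_mem hx] using hgc x hx
            · rw [Set.indicator_of_notMem hx]
              exact hg x
  choose L hL using fun f => cauchySeq_tendsto_of_complete (hc f)
  -- Shift by one: `averagedDual` at `n` has `n + 1` terms, so that it is always a probability
  -- measure.
  refine exists_tendsto_of_tendsto_integral (L := L) fun f =>
    (((hL f).comp (tendsto_add_atTop_nat 1))).congr fun n => ?_
  rw [integral_averagedDual, Function.comp_apply, cesaroMean_apply]
  simp only [BoundedContinuousFunction.coe_smul, BoundedContinuousFunction.coe_sum,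
    Finset.sum_apply, smul_eq_mul, S.opCb_pow, S.opCb_apply]

theorem asymptoticallyStable_of_lowerBound (hS : S.EPropertyCb) (h : S.LowerBound) :
    S.AsymptoticallyStable := by
  obtain ⟨z, hz⟩ := h
  replace hz : ∀ ε : ℝ, 0 < ε → 0 < ⨅ x : X, liminf (fun t : ℝ≥0 =>
    (S.dual t (diracPM x) : Measure X) (Metric.ball z ε)) atTop := hz
  have hdiff := fun f μ ν => S.tendsto_integral_dual_sub hS hz f μ ν
  obtain ⟨μ₀, hμ₀⟩ := S.exists_tendsto_averagedDual hS hz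
  have hlim := ProbabilityMeasure.tendsto_iff_forall_integral_tendsto.1 hμ₀
  have hinv : S.IsInvariant μ₀ := by
    intro s
    have : IsFiniteMeasure (S.dual s μ₀ : Measure X) := inferInstance
    have : IsFiniteMeasure (μ₀ : Measure X) := inferInstance
    refine Subtype.ext (ext_of_forall_integral_eq_of_IsFiniteMeasure
      (μ := (S.dual s μ₀ : Measure X)) (ν := (μ₀ : Measure X)) fun f => ?_)
    -- The averages started from `P_s^* δ_z` tend to `P_s^* μ₀` by the Feller property; by merging
    -- they have the same limit as those started from `δ_z`.
    have e1 : Tendsto (fun n => ∫ x, f x ∂(S.averagedDual (S.dual s (diracPM z)) n : Measure X))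
        atTop (𝓝 (∫ x, f x ∂(S.dual s μ₀ : Measure X))) := by
      rw [← S.integral_opCb]
      refine (hlim (S.opCb s f)).congr fun n => ?_
      simp_rw [integral_averagedDual, S.integral_opCb, ← S.dual_add, add_comm]
    have e2 : Tendsto (fun n =>
        ∫ x, f x ∂(S.averagedDual (S.dual s (diracPM z)) n : Measure X) -
        ∫ x, f x ∂(S.averagedDual (diracPM z) n : Measure X)) atTop (𝓝 0) := by
      have := (((hdiff f (S.dual s (diracPM z)) (diracPM z)).comp
        (tendsto_natCast_atTop_atTop (R := ℝ≥0))).cesaro).comp (tendsto_add_atTop_nat 1)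
      refine this.congr fun n => ?_
      simp only [integral_averagedDual, Function.comp_apply, Finset.sum_sub_distrib, mul_sub]
    exact sub_eq_zero.1 (tendsto_nhds_unique (e1.sub (hlim f)) e2)
  have hconv : ∀ μ, Tendsto (fun t : ℝ≥0 => S.dual t μ) atTop (𝓝 μ₀) := by
    intro μ
    refine ProbabilityMeasure.tendsto_iff_forall_integral_tendsto.2 fun f => ?_
    have := (hdiff f μ μ₀).add_const (∫ x, f x ∂(μ₀ : Measure X))
    simp_rw [hinv _] at this
    simpa using this
  refine ⟨μ₀, hinv, fun μ hμ => ?_, hconv⟩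
  have h1 := hconv μ
  simp_rw [hμ _] at h1
  exact tendsto_nhds_unique tendsto_const_nhds h1

end FellerSemigroup

/-! ### Necessity: nonempty support under non-measurable density. -/

section Support

variable {X : Type*} [MetricSpace X]

/-- Every open cover of a metric space has a countable family of refinements, each consisting of
pairwise disjoint open sets, that together cover the space. -/
theorem exists_sigma_disjoint_open_refinement {ι : Type*} {U : ι → Set X}
    (hU : ∀ i, IsOpen (U i)) (hcov : ⋃ i, U i = Set.univ) :
    ∃ G : ℕ → ι → Set X, (∀ n i, IsOpen (G n i)) ∧ (∀ n i, G n i ⊆ U i) ∧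
      (∀ n, Pairwise fun i j => Disjoint (G n i) (G n j)) ∧ ⋃ n, ⋃ i, G n i = Set.univ := by
  classical
  obtain ⟨_, _⟩ := exists_wellFoundedLT ι
  let r : ℕ → ℝ := fun n => 1 / (n + 1)
  have hr : ∀ n, 0 < r n := fun n => Nat.one_div_pos_of_nat
  -- Stone's construction with well-ordered indices: for `i < j`, points of `E n j` avoid `U i` and
  -- so are at distance at least `r n` from `E n i`. Balls of half that radius are therefore
  -- disjoint.
  let E : ℕ → ι → Set X := fun n i => {x | Metric.ball x (r n) ⊆ U i ∧ ∀ j < i, x ∉ U j}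
  let G : ℕ → ι → Set X := fun n i => ⋃ x ∈ E n i, Metric.ball x (r n / 2)
  have hlt : ∀ n {i j}, i < j → Disjoint (G n i) (G n j) := by
    intro n i j hij
    refine Set.disjoint_left.2 fun y hy hy' => ?_
    simp only [G, Set.mem_iUnion, exists_prop] at hy hy'
    obtain ⟨a, ha, hya⟩ := hy
    obtain ⟨b, hb, hyb⟩ := hy'
    refine hb.2 i hij (ha.1 ?_)
    rw [Metric.mem_ball] at hya hyb ⊢
    have := dist_triangle_left b a y
    linarith
  refine ⟨G, fun n i => isOpen_biUnion fun _ _ => Metric.isOpen_ball, fun n i => ?_,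
    fun n i j hij => ?_, Set.eq_univ_of_forall fun x => ?_⟩
  · exact Set.iUnion₂_subset fun x hx =>
      (Metric.ball_subset_ball (half_le_self (hr n).le)).trans hx.1
  · rcases lt_or_gt_of_ne hij with h | h
    · exact hlt n h
    · exact (hlt n h).symm
  · have hne : {i | x ∈ U i}.Nonempty := Set.mem_iUnion.1 (hcov ▸ Set.mem_univ x)
    let i := wellFounded_lt.min {i | x ∈ U i} hne
    obtain ⟨ε, hε, hball⟩ := Metric.isOpen_iff.1 (hU i) x (wellFounded_lt.min_mem _ hne)
    obtain ⟨n, hn⟩ := exists_nat_one_div_lt hε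
    refine Set.mem_iUnion.2 ⟨n, Set.mem_iUnion.2 ⟨i, Set.mem_biUnion ⟨?_, fun j hj hxj => ?_⟩
      (Metric.mem_ball_self (half_pos (hr n)))⟩⟩
    · exact (Metric.ball_subset_ball hn.le).trans hball
    · exact wellFounded_lt.not_lt_min _ (show j ∈ {i | x ∈ U i} from hxj) hj

variable [MeasurableSpace X] [BorelSpace X]

/-- On a space of non-measurable density, the union of a disjoint family of open null sets is
null. -/
theorem measure_iUnion_null_of_disjoint (hX : NonmeasurableDensity X) (μ : Measure X)
    [IsFiniteMeasure μ] {ι : Type*} {G : ι → Set X} (hG : ∀ i, IsOpen (G i))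
    (hdisj : Pairwise fun i j => Disjoint (G i) (G j)) (h0 : ∀ i, μ (G i) = 0) :
    μ (⋃ i, G i) = 0 := by
  classical
  by_contra hpos
  obtain ⟨D, hD, hm⟩ := hX
  have hGo : IsOpen (⋃ i, G i) := isOpen_iUnion hG
  have hpt : ∀ x ∈ ⋃ i, G i, ∃ i, x ∈ G i := fun x hx => Set.mem_iUnion.1 hx
  obtain ⟨x₀, hx₀⟩ := nonempty_of_measure_ne_zero hpos
  have : Nonempty ι := (hpt x₀ hx₀).nonempty
  choose! idx hidx using hpt
  have hidx_eq : ∀ {x i}, x ∈ G i → idx x = i := fun {x i} hx => by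
    by_contra hne
    exact Set.disjoint_left.1 (hdisj hne) (hidx x (Set.mem_iUnion.2 ⟨i, hx⟩)) hx
  have hsel : ∀ i, ∃ d : D, (G i).Nonempty → (d : X) ∈ G i := by
    intro i
    by_cases hi : (G i).Nonempty
    · obtain ⟨d, hd, hdD⟩ := hD.inter_open_nonempty _ (hG i) hi
      exact ⟨⟨d, hdD⟩, fun _ => hd⟩
    · obtain ⟨i₀, hi₀⟩ := Set.mem_iUnion.1 hx₀
      obtain ⟨d, hd, hdD⟩ := hD.inter_open_nonempty _ (hG i₀) ⟨_, hi₀⟩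
      exact ⟨⟨d, hdD⟩, fun h => absurd h hi⟩
  choose sel hsel using hsel
  -- Each `G i` collapses to one point of `D` inside it. Every subset of `D` pulls back within the
  -- union to an open set, so `g` is measurable for all subsets, and the conditioned `μ` is pushed
  -- to a forbidden measure on `D`.
  let g : X → D := fun x => if x ∈ ⋃ i, G i then sel (idx x) else sel (idx x₀)
  let _ : MeasurableSpace D := ⊤
  have hpre : ∀ A : Set D, g ⁻¹' A ∩ ⋃ i, G i = ⋃ i ∈ {i | sel i ∈ A}, G i := by
    intro A
    ext x
    simp only [Set.mem_inter_iff, Set.mem_preimage, Set.mem_iUnion, Set.mem_ofPred_eq,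
      exists_prop]
    constructor
    · rintro ⟨hx, i, hi⟩
      have hxG : x ∈ ⋃ i, G i := Set.mem_iUnion.2 ⟨i, hi⟩
      simp only [g, hxG, if_true, hidx_eq hi] at hx
      exact ⟨i, hx, hi⟩
    · rintro ⟨i, hiA, hi⟩
      have hxG : x ∈ ⋃ i, G i := Set.mem_iUnion.2 ⟨i, hi⟩
      refine ⟨?_, i, hi⟩
      simpa only [g, hxG, if_true, hidx_eq hi] using hiA
  have hopen : ∀ A : Set D, IsOpen (g ⁻¹' A ∩ ⋃ i, G i) := fun A => by
    rw [hpre]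
    exact isOpen_biUnion fun i _ => hG i
  have hg : Measurable g := by
    intro A _
    rw [← Set.inter_union_compl (g ⁻¹' A) (⋃ i, G i)]
    refine (hopen A).measurableSet.union ?_
    by_cases hA : sel (idx x₀) ∈ A
    · convert! hGo.measurableSet.compl using 1
      refine Set.inter_eq_right.2 fun x hx => ?_
      have hx : x ∉ ⋃ i, G i := hx
      simpa only [Set.mem_preimage, g, hx, if_false] using hA
    · convert! MeasurableSet.empty using 1
      refine Set.eq_empty_of_forall_notMem fun x ⟨hxA, hx⟩ => hA ?_
      have hx : x ∉ ⋃ i, G i := hx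
      simpa only [Set.mem_preimage, g, hx, if_false] using hxA
  have hprob : IsProbabilityMeasure (ProbabilityTheory.cond μ (⋃ i, G i)) :=
    ProbabilityTheory.cond_isProbabilityMeasure hpos
  obtain ⟨d, hd⟩ := hm ((ProbabilityTheory.cond μ (⋃ i, G i)).map g)
    (Measure.isProbabilityMeasure_map hg.aemeasurable)
  refine hd ?_
  rw [Measure.map_apply hg trivial, ProbabilityTheory.cond_apply hGo.measurableSet,
    Set.inter_comm, hpre]
  refine mul_eq_zero_of_right _ ?_
  -- At most one nonempty `G i` can select `d`, since `d` then lies in it; so the fibre over `d` is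
  -- null.
  by_cases h : ∃ i, sel i = d ∧ (G i).Nonempty
  · obtain ⟨i, hi, hne⟩ := h
    refine measure_mono_null (Set.iUnion₂_subset fun j hj x hx => ?_) (h0 i)
    have hj' := hsel j ⟨x, hx⟩
    have hi' := hsel i hne
    rw [show sel j = d from hj] at hj'
    rw [hi] at hi'
    rwa [← hidx_eq hi', hidx_eq hj']
  · push Not at h
    exact measure_mono_null (Set.iUnion₂_subset fun i hi => (h i hi).le) measure_empty

/-- Otherwise null balls cover `X`. Refined into countably many disjoint open families, each with
null union, they would give `X` measure zero. -/
theorem exists_forall_ball_measure_pos (hX : NonmeasurableDensity X) (μ : ProbabilityMeasure X) :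
    ∃ z : X, ∀ ε : ℝ, 0 < ε → 0 < (μ : Measure X) (Metric.ball z ε) := by
  by_contra! h
  choose ε hε h0 using h
  have hcov : ⋃ x, Metric.ball x (ε x) = Set.univ :=
    Set.eq_univ_of_forall fun x => Set.mem_iUnion.2 ⟨x, Metric.mem_ball_self (hε x)⟩
  obtain ⟨G, hGo, hGU, hGd, hGc⟩ :=
    exists_sigma_disjoint_open_refinement (fun x => Metric.isOpen_ball) hcov
  have : (μ : Measure X) Set.univ = 0 := by
    rw [← hGc]
    exact measure_iUnion_null fun n => measure_iUnion_null_of_disjoint hX _ (hGo n) (hGd n)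
      fun i => measure_mono_null (hGU n i) (nonpos_iff_eq_zero.1 (h0 i))
  simp at this

end Support

/-- For `z` in the support of `μ₀`, the portmanteau inequality bounds every lower limit below by `μ₀
(B(z, ε)) > 0`, independently of the starting point. -/
theorem FellerSemigroup.lowerBound_of_asymptoticallyStable {X : Type*} [MetricSpace X]
    [MeasurableSpace X] [BorelSpace X] (S : FellerSemigroup X) (hX : NonmeasurableDensity X)
    (h : S.AsymptoticallyStable) : S.LowerBound := by
  obtain ⟨μ₀, -, -, hconv⟩ := h
  obtain ⟨z, hz⟩ := exists_forall_ball_measure_pos hX μ₀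
  exact ⟨z, fun ε hε => (hz ε hε).trans_le (le_iInf fun x =>
    ProbabilityMeasure.le_liminf_measure_open_of_tendsto (hconv _) Metric.isOpen_ball)⟩

theorem theorem4p1 {X : Type*} [MetricSpace X] [MeasurableSpace X] [BorelSpace X]
    (S : FellerSemigroup X) (hS : S.EPropertyCb) :
    (S.LowerBound → S.AsymptoticallyStable) ∧
      (NonmeasurableDensity X → S.AsymptoticallyStable → S.LowerBound) :=
  ⟨S.asymptoticallyStable_of_lowerBound hS, S.lowerBound_of_asymptoticallyStable⟩
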